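/- A Petri net $N=(P,T,F)$ consists of a non-empty set $P$ of places, a non-empty set $T$ of transitions disjoint from $P$, and a flow relation $F\subseteq (P\times T)\cup(T\times P)$ such that the directed graph $(P\cup T,F)$ is weakly connected (neither set needs to be finite). For a node $x$ let ${}^{\bullet}x=\{y\mid (y,x)\in F\}$ and $x^{\bullet}=\{y\mid (x,y)\in F\}$. The net is free-choice if for all $t_1,t_2\in T$ either ${}^{\bullet}t_1={}^{\bullet}t_2$ or ${}^{\bullet}t_1\cap{}^{\bullet}t_2=\emptyset$, and proper if ${}^{\bullet}t\neq\emptyset$ and $t^{\bullet}\neq\emptyset$ for every $t\in T$. A marking is a multiset of places, i.e. a function $M:P\to\mathbb{N}$, and $(N,M)$ is called a marked net. A transition $t$ is enabled in $M$ if $M(p)\geq 1$ for all $p\in{}^{\bullet}t$; firing it then removes one token from each $p\in{}^{\bullet}t$ and adds one token to each $p\in t^{\bullet}$. Let $en(N,M)$ be the set of transitions enabled in $M$, and let $R(N,M)$ be the set of markings obtained from $M$ by firing finite (possibly empty) sequences of transitions. The cluster of a node $x\in P\cup T$ is the smallest set $C\subseteq P\cup T$ with $x\in C$ such that $p^{\bullet}\subseteq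 C$ for every place $p\in C$ and ${}^{\bullet}t\subseteq C$ for every transition $t\in C$. Let $Mrk(C)$ be the marking with exactly one token in each place of $C$ and no other tokens. A cluster $C$ is a home cluster of $(N,M)$ if $Mrk(C)\in R(N,M')$ for every $M'\in R(N,M)$. Corollary (Home Clusters Ensure Lucency). Let $(N,M)$ be a marked proper free-choice net that has a home cluster. Then $(N,M)$ is lucent: for all $M_1,M_2\in R(N,M)$, if $en(N,M_1)=en(N,M_2)$, then $M_1=M_2$. -/

import Mathlib

/-- A Petri net with places `P` and transitions `T`. The two types are disjoint by construction,
the nodes of the net are the elements of `P ⊕ T`. The flow relation is given by its two parts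
`inp ⊆ P × T` and `out ⊆ T × P`. The net is weakly connected, and it has at least one place and
at least one transition. No finiteness is required. -/
structure PetriNet (P T : Type*) where
  inp : Set (P × T)
  out : Set (T × P)
  nonempty_places : Nonempty P
  nonempty_transitions : Nonempty T
  /-- any two nodes are linked by a finite chain of arcs, each followed in either direction -/
  connected : ∀ x y : P ⊕ T, Relation.EqvGen
    (fun a b => (∃ p t, (p, t) ∈ inp ∧ a = Sum.inl p ∧ b = Sum.inr t) ∨
      (∃ t p, (t, p) ∈ out ∧ a = Sum.inr t ∧ b = Sum.inl p)) x y

namespace PetriNet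

variable {P T : Type*}

/-- The set of input places of a transition. -/
def pre (N : PetriNet P T) (t : T) : Set P := {p | (p, t) ∈ N.inp}

/-- The set of output places of a transition. -/
def post (N : PetriNet P T) (t : T) : Set P := {p | (t, p) ∈ N.out}

/-- A marking is a multiset of places, given by its multiplicity function (when there are
infinitely many places, the total number of tokens may be infinite). -/
abbrev Marking (P : Type*) := P → ℕ

/-- The multiset containing every element of a set of places exactly once. -/
noncomputable def single (Q : Set P) : Marking P := Q.indicator (fun _ => 1)

/-- A transition is enabled when each of its input places contains a token. -/
def Enabled (N : PetriNet P T) (M : Marking P) (t : T) : Prop := ∀ p ∈ N.pre t, 1 ≤ M p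

/-- The set of enabled transitions. -/
def en (N : PetriNet P T) (M : Marking P) : Set T := {t | N.Enabled M t}

/-- `t` is enabled in `M`, and firing it removes one token from each input place and then adds
one token to each output place, which results in `M'`. The subtraction does not truncate,
because `t` is enabled. -/
def Fires (N : PetriNet P T) (M : Marking P) (t : T) (M' : Marking P) : Prop :=
  N.Enabled M t ∧ ∀ p, M' p = M p - single (N.pre t) p + single (N.post t) p

/-- The finite sequence of transitions `σ` can be fired from `M` and leads to `M'`. -/
def FiresSeq (N : PetriNet P T) (M : Marking P) : List T → Marking P → Prop
  | [], M' => M = M'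
  | t :: σ, M' => ∃ M₁, N.Fires M t M₁ ∧ FiresSeq N M₁ σ M'

/-- The set of markings reachable from `M`. -/
def reach (N : PetriNet P T) (M : Marking P) : Set (Marking P) :=
  {M' | ∃ σ : List T, N.FiresSeq M σ M'}

/-- `H` is a home marking of the marked net `(N, M)`. -/
def IsHomeMarking (N : PetriNet P T) (M H : Marking P) : Prop :=
  ∀ M' ∈ N.reach M, H ∈ N.reach M'

/-- A set of nodes closed under going from a place to its output transitions and from a
transition to its input places. -/
def ClusterClosed (N : PetriNet P T) (X : Set (P ⊕ T)) : Prop :=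
  (∀ p t, Sum.inl p ∈ X → (p, t) ∈ N.inp → Sum.inr t ∈ X) ∧
  (∀ p t, Sum.inr t ∈ X → (p, t) ∈ N.inp → Sum.inl p ∈ X)

/-- The cluster of a node: the smallest closed set of nodes containing it. -/
def cluster (N : PetriNet P T) (x : P ⊕ T) : Set (P ⊕ T) :=
  ⋂₀ {X | x ∈ X ∧ N.ClusterClosed X}

/-- The set of clusters of the net. -/
def clusters (N : PetriNet P T) : Set (Set (P ⊕ T)) := Set.range N.cluster

/-- The places of a set of nodes. -/
def places (C : Set (P ⊕ T)) : Set P := {p | Sum.inl p ∈ C}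

/-- The smallest marking fully enabling a cluster: one token in each of its places. -/
noncomputable def mrk (C : Set (P ⊕ T)) : Marking P := single (places C)

/-- `C` is a home cluster of the marked net `(N, M)`. -/
def IsHomeCluster (N : PetriNet P T) (M : Marking P) (C : Set (P ⊕ T)) : Prop :=
  C ∈ N.clusters ∧ N.IsHomeMarking M (mrk C)

/-- The marked net `(N, M)` has a home cluster. -/
def HasHomeCluster (N : PetriNet P T) (M : Marking P) : Prop := ∃ C, N.IsHomeCluster M C

/-- Free-choice nets. -/
def FreeChoice (N : PetriNet P T) : Prop :=
  ∀ t₁ t₂ : T, N.pre t₁ = N.pre t₂ ∨ N.pre t₁ ∩ N.pre t₂ = ∅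

/-- Proper nets: each transition has an input place and an output place. -/
def Proper (N : PetriNet P T) : Prop :=
  ∀ t : T, (N.pre t).Nonempty ∧ (N.post t).Nonempty

/-- Lucent marked nets: a reachable marking is determined by the transitions it enables. -/
def Lucent (N : PetriNet P T) (M : Marking P) : Prop :=
  ∀ M₁ ∈ N.reach M, ∀ M₂ ∈ N.reach M, N.en M₁ = N.en M₂ → M₁ = M₂

end PetriNet

namespace PetriNet

variable {P T : Type*} {N : PetriNet P T}

/-! Let `Q` be the places of the home cluster. By free choice, a transition consuming from `Q` has
preset `Q`. A reachable marking cannot strictly dominate another (`FreeChoice.eq_of_le`), so one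
that covers `Q` equals `single Q`. Reading runs to `single Q` backwards yields one acyclic list of
transitions, a ladder, covering the supports of both markings (`FreeChoice.exists_ladder`). Firing
its transitions greedily ends in `single Q` (`FreeChoice.exists_ladder_run`). In such a run no
transition occurs twice, and the enabled set of the starting marking decides which ones occur
(`IsLadder.count_eq_count`). Two markings enabling the same transitions thus have runs to `single Q`
with equal transition counts, and the marking equation makes them equal. -/

/-! ### Clusters of free-choice nets. -/

theorem FreeChoice.pre_eq (hfc : N.FreeChoice) {t₁ t₂ : T} {p : P} (h₁ : p ∈ N.pre t₁)
    (h₂ : p ∈ N.pre t₂) : N.pre t₁ = N.pre t₂ := by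
  rcases hfc t₁ t₂ with h | h
  · exact h
  · exact absurd (show p ∈ N.pre t₁ ∩ N.pre t₂ from ⟨h₁, h₂⟩) (by simp [h])

theorem clusterClosed_cluster (x : P ⊕ T) : N.ClusterClosed (N.cluster x) :=
  ⟨fun p t hp hpt X hX => hX.2.1 p t (hp X hX) hpt,
    fun p t ht hpt X hX => hX.2.2 p t (ht X hX) hpt⟩

/-- In a free-choice net, every transition consuming from a cluster consumes exactly from the
places of that cluster. -/
theorem FreeChoice.pre_eq_places (hfc : N.FreeChoice) {C : Set (P ⊕ T)} (hC : C ∈ N.clusters)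
    {p : P} {t : T} (hp : p ∈ places C) (hpt : p ∈ N.pre t) : N.pre t = places C := by
  obtain ⟨x, rfl⟩ := hC
  set X : Set (P ⊕ T) := Sum.inl '' N.pre t ∪ Sum.inr '' {t' | N.pre t' = N.pre t} with hXdef
  have hl : ∀ q, Sum.inl q ∈ X ↔ q ∈ N.pre t := by simp [hXdef]
  have hr : ∀ s, Sum.inr s ∈ X ↔ N.pre s = N.pre t := by simp [hXdef]
  have hX : N.ClusterClosed X :=
    ⟨fun q s hq hqs => (hr s).2 (hfc.pre_eq (p := q) hqs ((hl q).1 hq)),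
      fun q s hs hqs => (hl q).2 ((hr s).1 hs ▸ hqs)⟩
  -- With the complement closed as well, a cluster meeting `X` must start in `X`.
  have hXc : N.ClusterClosed Xᶜ :=
    ⟨fun q s hq hqs hs => hq (hX.2 q s hs hqs), fun q s hs hqs hq => hs (hX.1 q s hq hqs)⟩
  have hx : x ∈ X := by
    by_contra hx
    exact hp Xᶜ ⟨hx, hXc⟩ ((hl p).2 hpt)
  refine Set.Subset.antisymm (fun q hq => ?_) (fun q hq => (hl q).1 (hq X ⟨hx, hX⟩))
  exact (clusterClosed_cluster x).2 q t ((clusterClosed_cluster x).1 p t hp hpt) hq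

/-! ### Firing and reachability. -/

theorem single_of_mem {Q : Set P} {p : P} (h : p ∈ Q) : single Q p = 1 := by
  simp [single, h]

theorem single_of_notMem {Q : Set P} {p : P} (h : p ∉ Q) : single Q p = 0 := by
  simp [single, h]

theorem single_le_iff {Q : Set P} {M : Marking P} : single Q ≤ M ↔ ∀ p ∈ Q, 1 ≤ M p := by
  refine ⟨fun h p hp => single_of_mem hp ▸ h p, fun h p => ?_⟩
  by_cases hp : p ∈ Q
  · exact single_of_mem hp ▸ h p hp
  · simp [single_of_notMem hp]

theorem Enabled.mono {M M' : Marking P} {t : T} (h : N.Enabled M t) (hM : M ≤ M') :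
    N.Enabled M' t := fun p hp => (h p hp).trans (hM p)

theorem Enabled.congr_pre {M : Marking P} {t t' : T} (h : N.Enabled M t)
    (ht : N.pre t' = N.pre t) : N.Enabled M t' := fun p hp => h p (ht ▸ hp)

theorem Enabled.exists_fires {M : Marking P} {t : T} (h : N.Enabled M t) :
    ∃ M', N.Fires M t M' := ⟨_, h, fun _ => rfl⟩

theorem Fires.add_eq {M M' : Marking P} {t : T} (h : N.Fires M t M') (p : P) :
    M' p + single (N.pre t) p = M p + single (N.post t) p := by
  have h₁ : single (N.pre t) p ≤ M p := single_le_iff.2 h.1 p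
  have h₂ := h.2 p
  omega

theorem fires_iff {M M' : Marking P} {t : T} : N.Fires M t M' ↔ N.Enabled M t ∧
    ∀ p, M' p + single (N.pre t) p = M p + single (N.post t) p := by
  refine ⟨fun h => ⟨h.1, h.add_eq⟩, fun h => ⟨h.1, fun p => ?_⟩⟩
  have h₁ : single (N.pre t) p ≤ M p := single_le_iff.2 h.1 p
  have h₂ := h.2 p
  omega

theorem Fires.le_of_notMem_pre {M M' : Marking P} {t : T} (h : N.Fires M t M') {p : P}
    (hp : p ∉ N.pre t) : M p ≤ M' p := by
  have := h.add_eq p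
  rw [single_of_notMem hp] at this
  omega

theorem Fires.one_le_of_mem_post {M M' : Marking P} {t : T} (h : N.Fires M t M') {p : P}
    (hp : p ∈ N.post t) : 1 ≤ M' p := by
  have := h.2 p
  rw [single_of_mem hp] at this
  omega

theorem Fires.mem_reach {M M' : Marking P} {t : T} (h : N.Fires M t M') : M' ∈ N.reach M :=
  ⟨[t], M', h, rfl⟩

theorem FiresSeq.append {σ τ : List T} : ∀ {M₁ M₂ M₃ : Marking P}, N.FiresSeq M₁ σ M₂ →
    N.FiresSeq M₂ τ M₃ → N.FiresSeq M₁ (σ ++ τ) M₃ := by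
  induction σ with
  | nil => rintro M₁ M₂ M₃ rfl h; exact h
  | cons t σ ih => rintro M₁ M₂ M₃ ⟨M', h, h'⟩ h''; exact ⟨M', h, ih h' h''⟩

theorem reach_trans {M₁ M₂ M₃ : Marking P} (h : M₂ ∈ N.reach M₁) (h' : M₃ ∈ N.reach M₂) :
    M₃ ∈ N.reach M₁ := by
  obtain ⟨σ, hσ⟩ := h
  obtain ⟨τ, hτ⟩ := h'
  exact ⟨σ ++ τ, hσ.append hτ⟩

theorem mem_reach_self (M : Marking P) : M ∈ N.reach M := ⟨[], rfl⟩

theorem IsHomeMarking.mono {M M' H : Marking P} (h : N.IsHomeMarking M H)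
    (hM : M' ∈ N.reach M) : N.IsHomeMarking M' H := fun _ hA => h _ (reach_trans hM hA)

/-! ### Reordering runs; no strict domination. -/

/-- Two transitions with disjoint presets, enabled one after the other, where the second one is
enabled from the start, can be fired in the other order. -/
theorem Fires.swap {M₁ M₂ M₃ : Marking P} {t v : T} (ht : N.Fires M₁ t M₂)
    (hv : N.Fires M₂ v M₃) (hv₁ : N.Enabled M₁ v) (hd : N.pre t ∩ N.pre v = ∅) :
    ∃ M', N.Fires M₁ v M' ∧ N.Fires M' t M₃ := by
  obtain ⟨M', hM'⟩ := hv₁.exists_fires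
  refine ⟨M', hM', fires_iff.2 ⟨fun p hp => ?_, fun p => ?_⟩⟩
  · have hpv : p ∉ N.pre v := fun h => by
      have : p ∈ N.pre t ∩ N.pre v := ⟨hp, h⟩
      simp [hd] at this
    exact (ht.1 p hp).trans (hM'.le_of_notMem_pre hpv)
  · have h₁ := ht.add_eq p
    have h₂ := hv.add_eq p
    have h₃ := hM'.add_eq p
    omega

/-- Expediting: if `u` is enabled and its preset is consumed in a run, then the first transition
of the run consuming this preset can be moved to the front. -/
theorem FreeChoice.expedite (hfc : N.FreeChoice) {u : T} {H : Marking P} (σ : List T) :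
    ∀ {B : Marking P}, N.FiresSeq B σ H → N.Enabled B u → (∃ t ∈ σ, N.pre t = N.pre u) →
    ∃ v σ' B', N.pre v = N.pre u ∧ σ'.length < σ.length ∧ N.Fires B v B' ∧
      N.FiresSeq B' σ' H := by
  induction σ with
  | nil => simp
  | cons t σ ih =>
    rintro B ⟨B₁, ht, hσ⟩ hu hex
    by_cases htu : N.pre t = N.pre u
    · exact ⟨t, σ, B₁, htu, by simp, ht, hσ⟩
    · have hd := (hfc t u).resolve_left htu
      have hu₁ : N.Enabled B₁ u := fun p hp =>
        (hu p hp).trans (ht.le_of_notMem_pre fun h => htu (hfc.pre_eq h hp))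
      obtain ⟨v, σ', B', hv, hlen, hf, hσ'⟩ := ih hσ hu₁ (by simpa [htu] using hex)
      obtain ⟨B'', hf₁, hf₂⟩ := ht.swap hf (hu.congr_pre hv) (hv ▸ hd)
      exact ⟨v, t :: σ', B'', hv, by simpa using hlen, hf₁, B', hf₂, hσ'⟩

theorem FiresSeq.le_of_notMem_pre {p : P} {M' : Marking P} {σ : List T} :
    ∀ {M : Marking P}, N.FiresSeq M σ M' → (∀ t ∈ σ, p ∉ N.pre t) → M p ≤ M' p := by
  induction σ with
  | nil => rintro M rfl _; exact le_rfl
  | cons t σ ih =>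
    rintro M ⟨M₁, ht, hσ⟩ h
    exact (ht.le_of_notMem_pre (h t (by simp))).trans (ih hσ fun s hs => h s (by simp [hs]))

/-- Tokens added to `single Q` cannot disappear without consuming from `Q`. -/
theorem Proper.eq_of_firesSeq_single (hproper : N.Proper) {Q : Set P} {σ : List T} :
    ∀ {M : Marking P}, N.FiresSeq M σ (single Q) → (∀ t ∈ σ, ∀ p ∈ Q, p ∉ N.pre t) →
    single Q ≤ M → M = single Q := by
  induction σ with
  | nil => rintro M h _ _; exact h
  | cons t σ ih =>
    rintro M ⟨M₁, ht, hσ⟩ h hM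
    have htQ : ∀ p ∈ Q, p ∉ N.pre t := h t (by simp)
    have hM₁ : M₁ = single Q := by
      refine ih hσ (fun s hs => h s (by simp [hs])) (single_le_iff.2 fun p hp => ?_)
      exact (single_le_iff.1 hM p hp).trans (ht.le_of_notMem_pre (htQ p hp))
    -- A firing is impossible here: its output token would be a second one on a place of `Q`, or lie
    -- outside `Q`.
    obtain ⟨p, hp⟩ := (hproper t).2
    have h₁ := ht.one_le_of_mem_post hp
    have h₂ := ht.add_eq p
    by_cases hpQ : p ∈ Q
    · have h₃ := single_le_iff.1 hM p hpQ
      rw [single_of_notMem (htQ p hpQ), single_of_mem hp, hM₁, single_of_mem hpQ] at h₂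
      omega
    · rw [hM₁, single_of_notMem hpQ] at h₁
      omega

theorem IsHomeMarking.eq_of_dead {A H : Marking P} (hH : N.IsHomeMarking A H)
    (hA : ∀ t, ¬ N.Enabled A t) : A = H := by
  obtain ⟨σ, hσ⟩ := hH A (mem_reach_self A)
  cases σ with
  | nil => exact hσ
  | cons t σ => obtain ⟨_, ht, _⟩ := hσ; exact absurd ht.1 (hA t)

/-- If the home marking of a cluster is reachable from `B`, then no marking strictly below `B`
has it as a home marking. -/
theorem FreeChoice.eq_of_le (hfc : N.FreeChoice) (hproper : N.Proper) {Q : Set P}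
    (hQ : ∀ t, ∀ p ∈ Q, p ∈ N.pre t → N.pre t = Q) (n : ℕ) :
    ∀ {σ : List T} {A B : Marking P}, σ.length = n → N.IsHomeMarking A (single Q) →
      N.FiresSeq B σ (single Q) → A ≤ B → A = B := by
  induction n using Nat.strong_induction_on with
  | _ n ih =>
    rintro σ A B rfl hA hσ hAB
    by_cases hex : ∃ u, N.Enabled A u ∧ ∃ t ∈ σ, N.pre t = N.pre u
    · obtain ⟨u, hu, hut⟩ := hex
      obtain ⟨v, σ', B', hv, hlen, hB', hσ'⟩ := hfc.expedite σ hσ (hu.mono hAB) hut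
      obtain ⟨A', hA'⟩ := (hu.congr_pre hv).exists_fires
      -- Firing `v` on both sides preserves the order and shortens the run; equality then pulls back
      -- through the marking equation.
      have key : A' = B' := by
        refine ih _ hlen rfl (hA.mono hA'.mem_reach) hσ' fun p => ?_
        have h₁ := hA'.add_eq p
        have h₂ := hB'.add_eq p
        have h₃ : A p ≤ B p := hAB p
        change A' p ≤ B' p
        omega
      funext p
      have h₁ := hA'.add_eq p
      have h₂ := hB'.add_eq p
      rw [key] at h₁
      omega
    · push Not at hex
      suffices h : single Q ≤ A ∧ ∀ t ∈ σ, ∀ p ∈ Q, p ∉ N.pre t by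
        have hB := hproper.eq_of_firesSeq_single hσ h.2 (h.1.trans hAB)
        exact le_antisymm hAB (hB ▸ h.1)
      by_cases hdead : ∃ u, N.Enabled A u
      · obtain ⟨u, hu⟩ := hdead
        -- The run never consumes from `N.pre u`, so these tokens survive in `single Q`.
        have hpersist : ∀ p ∈ N.pre u, p ∈ Q := fun p hp => by
          by_contra hpQ
          have h₁ := hσ.le_of_notMem_pre fun t ht hpt => hex u hu t ht (hfc.pre_eq hpt hp)
          have h₂ := (hu p hp).trans (hAB p)
          rw [single_of_notMem hpQ] at h₁
          omega
        obtain ⟨p, hp⟩ := (hproper u).1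
        have huQ := hQ u p (hpersist p hp) hp
        exact ⟨single_le_iff.2 fun q hq => hu q (huQ ▸ hq), fun t ht q hq hqt =>
          hex u hu t ht ((hQ t q hq hqt).trans huQ.symm)⟩
      · push Not at hdead
        have hAH := hA.eq_of_dead hdead
        refine ⟨hAH.ge, fun t _ q hq hqt => hdead t ?_⟩
        intro r hr
        exact single_le_iff.1 hAH.ge r (hQ t q hq hqt ▸ hr)

/-- A reachable marking covering a home cluster is the marking of this cluster. -/
theorem FreeChoice.eq_single_of_le (hfc : N.FreeChoice) (hproper : N.Proper) {Q : Set P}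
    (hQ : ∀ t, ∀ p ∈ Q, p ∈ N.pre t → N.pre t = Q) {M : Marking P}
    (hM : N.IsHomeMarking M (single Q)) (hle : single Q ≤ M) : M = single Q := by
  have hreach := hM M (mem_reach_self M)
  obtain ⟨σ, hσ⟩ := hreach
  exact (hfc.eq_of_le hproper hQ _ rfl (hM.mono ⟨σ, hσ⟩) hσ hle).symm

/-! ### Ladders and runs along them. -/

/-- The places in `Q` or in the preset of some transition of `L`. -/
def cover (N : PetriNet P T) (Q : Set P) (L : List T) : Set P :=
  {p | p ∈ Q ∨ ∃ t ∈ L, p ∈ N.pre t}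

/-- A list of transitions with pairwise disjoint presets outside `Q`, each of which produces only
into `Q` and into the presets of later transitions. -/
def IsLadder (N : PetriNet P T) (Q : Set P) : List T → Prop
  | [] => True
  | t :: L => (∀ p ∈ N.pre t, p ∉ N.cover Q L) ∧ N.post t ⊆ N.cover Q L ∧ IsLadder N Q L

theorem cover_cons {Q : Set P} {t : T} {L : List T} :
    N.cover Q (t :: L) = N.pre t ∪ N.cover Q L := by
  ext p
  simp [cover]
  tauto

theorem cover_mono {Q : Set P} {L L' : List T} (h : L ⊆ L') : N.cover Q L ⊆ N.cover Q L' := by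
  rintro p (hp | ⟨t, ht, hp⟩)
  · exact Or.inl hp
  · exact Or.inr ⟨t, h ht, hp⟩

/-- Every ladder can be extended to cover the support of a marking from which `single Q` is
reachable. -/
theorem FreeChoice.exists_ladder (hfc : N.FreeChoice) {Q : Set P}
    (hQ : ∀ t, ∀ p ∈ Q, p ∈ N.pre t → N.pre t = Q) {L₀ : List T} (hL₀ : N.IsLadder Q L₀)
    (σ : List T) : ∀ {M : Marking P}, N.FiresSeq M σ (single Q) →
      ∃ L, N.IsLadder Q L ∧ L₀ ⊆ L ∧ ∀ p, M p ≠ 0 → p ∈ N.cover Q L := by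
  induction σ with
  | nil =>
    rintro M rfl
    refine ⟨L₀, hL₀, fun _ h => h, fun p hp => Or.inl ?_⟩
    by_contra h
    exact hp (single_of_notMem h)
  | cons t σ ih =>
    rintro M ⟨M₁, ht, hσ⟩
    obtain ⟨L, hL, hsub, hcov⟩ := ih hσ
    have hM : ∀ p, M p ≠ 0 → p ∈ N.pre t ∨ p ∈ N.cover Q L := fun p hp => by
      by_cases hpt : p ∈ N.pre t
      · exact Or.inl hpt
      · exact Or.inr (hcov p (by have := ht.le_of_notMem_pre hpt; omega))
    -- If the preset meets the cover, free choice puts it inside. Otherwise `t` can head the ladder: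
    -- its outputs are marked in `M₁`, hence covered.
    by_cases hmeet : ∃ p ∈ N.pre t, p ∈ N.cover Q L
    · obtain ⟨p, hpt, hp⟩ := hmeet
      have hpre : N.pre t ⊆ N.cover Q L := by
        rcases hp with hp | ⟨s, hs, hp⟩
        · rw [hQ t p hp hpt]
          exact fun q hq => Or.inl hq
        · rw [hfc.pre_eq hpt hp]
          exact fun q hq => Or.inr ⟨s, hs, hq⟩
      exact ⟨L, hL, hsub, fun q hq => (hM q hq).elim (fun h => hpre h) id⟩
    · push Not at hmeet
      refine ⟨t :: L, ⟨hmeet, fun p hp => hcov p ?_, hL⟩, fun s hs => by simp [hsub hs],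
        fun p hp => ?_⟩
      · have := ht.one_le_of_mem_post hp
        omega
      · rw [cover_cons]
        exact hM p hp

/-- Firing only transitions of a ladder that covers a marking leads to the home marking. -/
theorem FreeChoice.exists_ladder_run (hfc : N.FreeChoice) (hproper : N.Proper) {Q : Set P}
    (hQ : ∀ t, ∀ p ∈ Q, p ∈ N.pre t → N.pre t = Q) {L : List T} (hL : N.IsLadder Q L) :
    ∀ {D : Set T} {M : Marking P}, (∀ t ∈ D, ∀ p ∈ N.pre t, p ∉ N.cover Q L) →
      (∀ t ∈ D, ¬ N.Enabled M t) → N.IsHomeMarking M (single Q) →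
      (∀ p, M p ≠ 0 → p ∈ N.cover Q L ∨ ∃ t ∈ D, p ∈ N.pre t) →
      ∃ τ ⊆ L, N.FiresSeq M τ (single Q) := by
  -- `D` collects the transitions already passed over as disabled. They stay disabled, because the
  -- remaining ladder never produces into their presets.
  induction L with
  | nil =>
    intro D M _ hdis hM hcov
    refine ⟨[], by simp, ?_⟩
    by_cases hdead : ∃ u, N.Enabled M u
    · obtain ⟨u, hu⟩ := hdead
      obtain ⟨p, hp⟩ := (hproper u).1
      -- An enabled transition consumes from `Q`, since sharing an input place with some `t ∈ D`
      -- would enable `t`.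
      rcases hcov p (by have := hu p hp; omega) with (hpQ | ⟨t, ht, _⟩) | ⟨t, ht, hpt⟩
      · have huQ := hQ u p hpQ hp
        exact hfc.eq_single_of_le hproper hQ hM (single_le_iff.2 fun q hq => hu q (huQ ▸ hq))
      · simp at ht
      · exact absurd (hu.congr_pre (hfc.pre_eq hpt hp)) (hdis t ht)
    · push Not at hdead
      exact hM.eq_of_dead hdead
  | cons v L ih =>
    obtain ⟨hv, hpost, hL'⟩ := hL
    intro D M hD hdis hM hcov
    obtain ⟨p₀, hp₀⟩ := (hproper v).1
    -- Each firing of `v` lowers `M p₀` by one, as `v` does not produce into its own preset.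
    generalize hn : M p₀ = n
    induction n generalizing M with
    | zero =>
      obtain ⟨τ, hτL, hτ⟩ := ih hL' (D := insert v D) (M := M)
        (by
          rintro t (rfl | ht) p hp
          · exact hv p hp
          · exact fun h => hD t ht p hp (cover_cons ▸ Or.inr h))
        (by
          rintro t (rfl | ht) h
          · have := h p₀ hp₀
            omega
          · exact hdis t ht h) hM
        (by
          intro p hp
          rcases hcov p hp with h | ⟨t, ht, h⟩
          · rw [cover_cons] at h
            rcases h with h | h
            · exact Or.inr ⟨v, by simp, h⟩
            · exact Or.inl h
          · exact Or.inr ⟨t, by simp [ht], h⟩)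
      exact ⟨τ, fun t ht => by simp [hτL ht], hτ⟩
    | succ n ihn =>
      by_cases hen : N.Enabled M v
      · obtain ⟨M', hM'⟩ := hen.exists_fires
        have hsame : ∀ p, p ∉ N.post v → M' p ≤ M p := fun p hp => by
          have := hM'.add_eq p
          rw [single_of_notMem hp] at this
          omega
        obtain ⟨τ, hτL, hτ⟩ := ihn (M := M')
          (by
            intro t ht h
            refine hdis t ht fun p hp => (h p hp).trans (hsame p fun hpv => ?_)
            exact hD t ht p hp (cover_cons ▸ Or.inr (hpost hpv)))
          (hM.mono hM'.mem_reach)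
          (by
            intro p hp
            by_cases hpv : p ∈ N.post v
            · exact Or.inl (cover_cons ▸ Or.inr (hpost hpv))
            · exact hcov p (by have := hsame p hpv; omega))
          (by
            have := hM'.add_eq p₀
            rw [single_of_mem hp₀, single_of_notMem fun h => hv p₀ hp₀ (hpost h)] at this
            omega)
        exact ⟨v :: τ, by simp [hτL], M', hM', hτ⟩
      · obtain ⟨τ, hτL, hτ⟩ := ih hL' (D := insert v D) (M := M)
          (by
            rintro t (rfl | ht) p hp
            · exact hv p hp
            · exact fun h => hD t ht p hp (cover_cons ▸ Or.inr h))
          (by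
            rintro t (rfl | ht) h
            · exact hen h
            · exact hdis t ht h) hM
          (by
            intro p hp
            rcases hcov p hp with h | ⟨t, ht, h⟩
            · rw [cover_cons] at h
              rcases h with h | h
              · exact Or.inr ⟨v, by simp, h⟩
              · exact Or.inl h
            · exact Or.inr ⟨t, by simp [ht], h⟩)
        exact ⟨τ, fun t ht => by simp [hτL ht], hτ⟩

/-! ### Counting occurrences in ladder runs. -/

open Classical in
/-- The marking equation. -/
theorem FiresSeq.add_countP {M' : Marking P} (p : P) {σ : List T} : ∀ {M : Marking P},
    N.FiresSeq M σ M' → M' p + σ.countP (p ∈ N.pre ·) = M p + σ.countP (p ∈ N.post ·) := by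
  induction σ with
  | nil => rintro M rfl; simp
  | cons t σ ih =>
    rintro M ⟨M₁, ht, hσ⟩
    have h₁ := ih hσ
    have h₂ := ht.add_eq p
    simp only [single, Set.indicator_apply] at h₂
    simp only [List.countP_cons, decide_eq_true_eq]
    omega

open Classical in
theorem countP_eq_of_count_eq {q : T → Prop} {τ₁ τ₂ : List T}
    (h : ∀ t, q t → τ₁.count t = τ₂.count t) :
    τ₁.countP (q ·) = τ₂.countP (q ·) := by
  rw [List.countP_eq_length_filter, List.countP_eq_length_filter]
  refine List.Perm.length_eq (List.perm_iff_count.2 fun t => ?_)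
  by_cases ht : q t
  · rw [List.count_filter (by simpa using ht), List.count_filter (by simpa using ht), h t ht]
  · rw [List.count_eq_zero_of_not_mem (by simp [ht]), List.count_eq_zero_of_not_mem (by simp [ht])]

/-- Consecutive parts of a ladder. -/
theorem IsLadder.of_append {Q : Set P} {L₁ L₂ : List T} (h : N.IsLadder Q (L₁ ++ L₂)) :
    N.IsLadder Q L₂ := by
  induction L₁ with
  | nil => exact h
  | cons t L₁ ih => exact ih h.2.2

/-- The presets of a ladder are disjoint from `Q`. -/
theorem IsLadder.notMem_pre {Q : Set P} {L : List T} (h : N.IsLadder Q L) {t : T} (ht : t ∈ L)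
    {p : P} (hp : p ∈ Q) : p ∉ N.pre t := by
  obtain ⟨L₁, L₂, rfl⟩ := List.append_of_mem ht
  exact fun hpt => h.of_append.1 p hpt (Or.inl hp)

/-- Transitions of a ladder sharing an input place are equal. -/
theorem IsLadder.eq_of_mem_pre {Q : Set P} {L : List T} (h : N.IsLadder Q L) {s t : T}
    (hs : s ∈ L) (ht : t ∈ L) {p : P} (hps : p ∈ N.pre s) (hpt : p ∈ N.pre t) : s = t := by
  induction L with
  | nil => simp at hs
  | cons v L ih =>
    obtain ⟨hv, -, hL⟩ := h
    rcases List.mem_cons.1 hs with rfl | hs' <;> rcases List.mem_cons.1 ht with rfl | ht'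
    · rfl
    · exact absurd (Or.inr ⟨t, ht', hpt⟩) (hv p hps)
    · exact absurd (Or.inr ⟨s, hs', hps⟩) (hv p hpt)
    · exact ih hL hs' ht'

open Classical in
theorem IsLadder.countP_pre {Q : Set P} {L τ : List T} (h : N.IsLadder Q L) (hτ : τ ⊆ L) {t : T}
    (ht : t ∈ L) {p : P} (hp : p ∈ N.pre t) : τ.countP (p ∈ N.pre ·) = τ.count t := by
  refine List.countP_congr fun s hs => ?_
  simp only [decide_eq_true_eq, beq_iff_eq]
  exact ⟨fun hps => h.eq_of_mem_pre (hτ hs) ht hps hp, fun e => e ▸ hp⟩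

open Classical in
/-- In a run from `M` to `single Q` along a ladder, the transition `t` occurs as often as its
input place `p` is filled. -/
theorem IsLadder.count_eq {Q : Set P} {L τ : List T} (h : N.IsLadder Q L) (hτ : τ ⊆ L)
    {M : Marking P} (hM : N.FiresSeq M τ (single Q)) {t : T} (ht : t ∈ L) {p : P}
    (hp : p ∈ N.pre t) : τ.count t = M p + τ.countP (p ∈ N.post ·) := by
  have h₁ := hM.add_countP p
  rwa [h.countP_pre hτ ht hp, single_of_notMem fun hpQ => h.notMem_pre ht hpQ hp, zero_add] at h₁

open Classical in
/-- A run to `single Q` along a ladder fires each transition at most once. -/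
theorem IsLadder.count_le_one {Q : Set P} (hproper : N.Proper) {L τ : List T}
    (h : N.IsLadder Q L) (hτ : τ ⊆ L) {M : Marking P} (hM : N.FiresSeq M τ (single Q)) (t : T) :
    τ.count t ≤ 1 := by
  by_cases ht : t ∈ τ
  swap
  · simp [List.count_eq_zero_of_not_mem ht]
  replace ht := hτ ht
  -- Induction from the end of the ladder: an output of `t` either stays in `Q`, which finally holds
  -- one token per place, or must be consumed by a later transition.
  suffices hsuf : ∀ L₂ L₁, L = L₁ ++ L₂ → ∀ t ∈ L₂, τ.count t ≤ 1 from hsuf L [] rfl t ht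
  intro L₂
  induction L₂ with
  | nil => simp
  | cons v L₂ ih =>
    intro L₁ hL
    have ih' := ih (L₁ ++ [v]) (by simp [hL])
    intro t ht
    rcases List.mem_cons.1 ht with rfl | ht
    swap
    · exact ih' t ht
    obtain ⟨p, hp⟩ := (hproper t).2
    have hle : τ.count t ≤ τ.countP (p ∈ N.post ·) :=
      List.countP_mono_left fun s _ hs => by
        rw [beq_iff_eq] at hs
        simpa [hs] using hp
    have hlad : N.IsLadder Q (t :: L₂) := (hL ▸ h).of_append
    rcases hlad.2.1 hp with hpQ | ⟨s, hs, hps⟩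
    · have h₁ := hM.add_countP p
      rw [single_of_mem hpQ, List.countP_eq_zero.2] at h₁
      · omega
      · intro s hs
        simpa using h.notMem_pre (hτ hs) hpQ
    · have h₁ := h.count_eq hτ hM (by simp [hL, hs]) hps
      have h₂ := ih' s hs
      omega

open Classical in
/-- Runs to `single Q` along the same ladder from two markings enabling the same transitions
consist of the same transitions. -/
theorem IsLadder.count_eq_count {Q : Set P} (hproper : N.Proper) {L τ₁ τ₂ : List T}
    (h : N.IsLadder Q L) (hτ₁ : τ₁ ⊆ L) (hτ₂ : τ₂ ⊆ L) {M₁ M₂ : Marking P}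
    (hM₁ : N.FiresSeq M₁ τ₁ (single Q)) (hM₂ : N.FiresSeq M₂ τ₂ (single Q))
    (hen : N.en M₁ = N.en M₂) (t : T) : τ₁.count t = τ₂.count t := by
  by_cases ht : t ∈ L
  swap
  · rw [List.count_eq_zero_of_not_mem fun h => ht (hτ₁ h),
      List.count_eq_zero_of_not_mem fun h => ht (hτ₂ h)]
  -- Induction from the front, because only earlier ladder transitions feed `N.pre t`.
  suffices hsuf : ∀ L₁ L₂, L = L₁ ++ L₂ → ∀ t ∈ L₁, τ₁.count t = τ₂.count t from
    hsuf L [] (by simp) t ht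
  intro L₁
  induction L₁ using List.reverseRecOn with
  | nil => simp
  | append_singleton L₁ v ih =>
    intro L₂ hL
    have ih' := ih (v :: L₂) (by simp [hL])
    intro t ht
    rcases List.mem_append.1 ht with ht | ht
    · exact ih' t ht
    obtain rfl := List.mem_singleton.1 ht
    have htL : t ∈ L := by simp [hL]
    have hlad : N.IsLadder Q (t :: L₂) := IsLadder.of_append (L₁ := L₁) (by simpa [hL] using h)
    have hin : ∀ p ∈ N.pre t, ∀ s ∈ L, p ∈ N.post s → s ∈ L₁ := by
      intro p hp s hs hps
      by_contra hsL₁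
      have hs' : s ∈ t :: L₂ := by
        rw [hL] at hs
        simpa [hsL₁] using hs
      obtain ⟨K₁, K₂, hK⟩ := List.append_of_mem hs'
      have hK' : N.IsLadder Q (s :: K₂) := (hK ▸ hlad).of_append
      have hpK : p ∈ N.cover Q L₂ := by
        refine cover_mono (L := K₂) ?_ (hK'.2.1 hps)
        cases K₁ with
        | nil => simp at hK; simp [hK.2]
        | cons a K₁ => simp at hK; simp [hK.2]
      exact hlad.1 p hp hpK
    have hflow : ∀ p ∈ N.pre t, τ₁.countP (p ∈ N.post ·) = τ₂.countP (p ∈ N.post ·) := by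
      intro p hp
      refine countP_eq_of_count_eq fun s hs => ?_
      by_cases hsL : s ∈ L
      · exact ih' s (hin p hp s hsL hs)
      · rw [List.count_eq_zero_of_not_mem fun h => hsL (hτ₁ h),
          List.count_eq_zero_of_not_mem fun h => hsL (hτ₂ h)]
    have hc₁ := fun p hp => h.count_eq hτ₁ hM₁ htL (p := p) hp
    have hc₂ := fun p hp => h.count_eq hτ₂ hM₂ htL (p := p) hp
    have hl₁ := h.count_le_one hproper hτ₁ hM₁ t
    have hl₂ := h.count_le_one hproper hτ₂ hM₂ t
    have henb : N.Enabled M₁ t ↔ N.Enabled M₂ t := Set.ext_iff.1 hen t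
    obtain ⟨p₀, hp₀⟩ := (hproper t).1
    -- Unequal counts are 0 and 1. Inflows agree and vanish, so the run with count 1 starts with `t`
    -- enabled, the other with `N.pre t` empty.
    rcases lt_trichotomy (τ₁.count t) (τ₂.count t) with hlt | heq | hlt
    · have he : N.Enabled M₂ t := fun p hp => by
        have := hc₁ p hp; have := hc₂ p hp; have := hflow p hp; omega
      have := henb.2 he p₀ hp₀
      have := hc₁ p₀ hp₀
      omega
    · exact heq
    · have he : N.Enabled M₁ t := fun p hp => by
        have := hc₁ p hp; have := hc₂ p hp; have := hflow p hp; omega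
      have := henb.1 he p₀ hp₀
      have := hc₂ p₀ hp₀
      omega

end PetriNet

/-! ### Lucency. -/

open PetriNet in
theorem corollary3 {P T : Type*} (N : PetriNet P T) (M : PetriNet.Marking P)
    (hproper : N.Proper) (hfc : N.FreeChoice) (hhome : N.HasHomeCluster M) :
    N.Lucent M := by
  classical
  obtain ⟨C, hC, hH⟩ := hhome
  have hQ : ∀ t, ∀ p ∈ places C, p ∈ N.pre t → N.pre t = places C :=
    fun t p hp hpt => hfc.pre_eq_places hC hp hpt
  intro M₁ hM₁ M₂ hM₂ hen
  have hH₁ : N.IsHomeMarking M₁ (single (places C)) := hH.mono hM₁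
  have hH₂ : N.IsHomeMarking M₂ (single (places C)) := hH.mono hM₂
  obtain ⟨σ₁, hσ₁⟩ := hH₁ M₁ (mem_reach_self _)
  obtain ⟨σ₂, hσ₂⟩ := hH₂ M₂ (mem_reach_self _)
  obtain ⟨L₁, hL₁, -, hcov₁⟩ := hfc.exists_ladder hQ (L₀ := []) trivial σ₁ hσ₁
  -- Extending `L₁` gives a single ladder for both markings, so that the two runs are comparable.
  obtain ⟨L, hL, hsub, hcov₂⟩ := hfc.exists_ladder hQ hL₁ σ₂ hσ₂
  obtain ⟨τ₁, hτ₁, hr₁⟩ := hfc.exists_ladder_run hproper hQ hL (D := ∅) (by simp) (by simp) hH₁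
    fun p hp => Or.inl (cover_mono hsub (hcov₁ p hp))
  obtain ⟨τ₂, hτ₂, hr₂⟩ := hfc.exists_ladder_run hproper hQ hL (D := ∅) (by simp) (by simp) hH₂
    fun p hp => Or.inl (hcov₂ p hp)
  have hcount := hL.count_eq_count hproper hτ₁ hτ₂ hr₁ hr₂ hen
  funext p
  have h₁ := hr₁.add_countP p
  have h₂ := hr₂.add_countP p
  rw [countP_eq_of_count_eq (q := (p ∈ N.pre ·)) fun t _ => hcount t,
    countP_eq_of_count_eq (q := (p ∈ N.post ·)) fun t _ => hcount t] at h₁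
  omega
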